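/- **Theorem (parameters of an elliptical Keplerian orbit).** Let $G, M_E, m_{LEO} > 0$ and let $\mathbf x_E, \mathbf x_L : \mathbb R \to \mathbb R^3$ be a collision-free, twice differentiable solution, defined for all times, of the Newtonian two-body problem for the point masses $M_E$ (Earth) and $m_{LEO}$ (satellite) with gravitational constant $G$. Put $\mu = G(M_E+m_{LEO})$, $\mathbf r = \mathbf x_L-\mathbf x_E$, $r = \lVert \mathbf r\rVert$, and let $$\varepsilon = \tfrac12\lVert\dot{\mathbf r}\rVert^2-\frac{\mu}{r},\qquad h = \lVert \mathbf r\times\dot{\mathbf r}\rVert$$ be the specific mechanical energy and the specific angular momentum at some time $t_0$. Suppose that the orbit is elliptical, that is, $\varepsilon<0$ and $h>0$. Define $$a=-\frac{\mu}{2\varepsilon},\qquad e=\sqrt{1+\frac{2\varepsilon h^2}{\mu^2}},\qquad b=a\sqrt{1-e^2},\qquad p=\frac{h^2}{\mu}.$$ Then: 1. The energy and the angular momentum equal $\varepsilon$ and $h$ at all times; the radicand in the definition of $e$ is non-negative and $0\le e<1$. The set $\{\mathbf r(t): t\in\mathbb R\}$ is an ellipse with semi-major axis $a$, semi-minor axis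 $b$ and eccentricity $e$, one of whose foci is the origin. The semi-latus rectum satisfies $p=a(1-e^2)$. If $t_p$ is any time at which $r$ is minimal (perigee) and the true anomaly $\theta(t)$ is the angle at the origin between $\mathbf r(t_p)$ and $\mathbf r(t)$, then $$r(t)=\frac{p}{1+e\cos\theta(t)}\qquad\text{for all } t.$$ 2. The minimum and the maximum of $r$ are attained and equal $a(1-e)$ and $a(1+e)$. If $R$ is the radius of the Earth, $H_p$ and $H_a$ are the minimum and the maximum of the altitude $r-R$, and $r_p=R+H_p$, $r_a=R+H_a$, then $r_p=a(1-e)$, $r_a=a(1+e)$ and $$a=\frac{r_p+r_a}{2},\qquad e=\frac{r_a-r_p}{r_a+r_p}.$$ 3. The circumference of the orbit, i.e. the length $\int_s^{s+T}\lVert\dot{\mathbf r}\rVert\,dt$ of the trajectory over one revolution (of duration $T$, from any starting time $s$), is $$C=4a\,E(e),\qquad E(e)=\int_0^{\pi/2}\sqrt{1-e^2\sin^2\varphi}\,d\varphi .$$ 4. The orbital period, i.e. the unique $T>0$ such that $\mathbf r$ is $T$-periodic and $\mathbf r(s+t)\ne\mathbf r(s)$ for all $s$ and all $0<t<T$, exists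 and is $$T=2\pi\sqrt{\frac{a^3}{\mu}} .$$ 5. The speed $v=\lVert\dot{\mathbf r}\rVert$ satisfies, at all times, the vis-viva equation $$v^2=\mu\left(\frac2r-\frac1a\right).$$ In particular, the speed is $v_p$ whenever $r=r_p$ and $v_a$ whenever $r=r_a$, where $$v_p^2=\mu\left(\frac{2}{r_p}-\frac1a\right)=\frac{\mu}{a}\,\frac{1+e}{1-e},\qquad v_a^2=\mu\left(\frac{2}{r_a}-\frac1a\right)=\frac{\mu}{a}\,\frac{1-e}{1+e}.$$ -/

import Mathlib

open Set

namespace Kepler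

/-- Three-dimensional Euclidean space. -/
abbrev Space : Type := EuclideanSpace ℝ (Fin 3)

/-- The vector product of two vectors of Euclidean three-space. -/
def cross (u v : Space) : Space :=
  WithLp.toLp 2 (crossProduct (WithLp.ofLp u) (WithLp.ofLp v))

/-- The trajectories `xE`, `xL` of two point masses `M`, `m` (twice differentiable, never
colliding, defined for all times) solve the Newtonian two-body problem with gravitational
constant `G`: mass times acceleration equals the gravitational attraction of the other body. -/
structure IsTwoBodyMotion (G M m : ℝ) (xE xL : ℝ → Space) : Prop where
  differentiable_E : Differentiable ℝ xE
  differentiable_L : Differentiable ℝ xL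
  differentiable_deriv_E : Differentiable ℝ (deriv xE)
  differentiable_deriv_L : Differentiable ℝ (deriv xL)
  no_collision : ∀ t, xE t ≠ xL t
  newton_E : ∀ t, M • deriv (deriv xE) t = (G * M * m / ‖xL t - xE t‖ ^ 3) • (xL t - xE t)
  newton_L : ∀ t, m • deriv (deriv xL) t = (G * M * m / ‖xE t - xL t‖ ^ 3) • (xE t - xL t)

/-- Specific mechanical energy at position `r` and velocity `v`. -/
noncomputable def specificEnergy (μ : ℝ) (r v : Space) : ℝ :=
  (1 / 2) * ‖v‖ ^ 2 - μ / ‖r‖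

/-- Specific angular momentum (its magnitude) at position `r` and velocity `v`. -/
noncomputable def specificAngularMomentum (r v : Space) : ℝ :=
  ‖cross r v‖

/-- `S` is an ellipse with semi-major axis `a`, semi-minor axis `b` and eccentricity `e`,
one of whose foci is the origin. Here `c` is the centre, `P` and `Q` are orthogonal unit vectors
along the major and the minor axis, and `c + √(a² - b²) P` is a focus. -/
def IsKeplerianEllipse (S : Set Space) (a b e : ℝ) : Prop :=
  0 < b ∧ b ≤ a ∧ e = Real.sqrt (1 - b ^ 2 / a ^ 2) ∧
    ∃ c P Q : Space, ‖P‖ = 1 ∧ ‖Q‖ = 1 ∧ inner ℝ P Q = 0 ∧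
      c + Real.sqrt (a ^ 2 - b ^ 2) • P = 0 ∧
      S = {z | ∃ x y : ℝ, x ^ 2 / a ^ 2 + y ^ 2 / b ^ 2 = 1 ∧ z = c + x • P + y • Q}

/-- `T` is the duration of a single revolution: the motion is periodic with period `T`, and it
does not come back to any of its positions after a shorter time. -/
def IsOrbitalPeriod (r : ℝ → Space) (T : ℝ) : Prop :=
  0 < T ∧ Function.Periodic r T ∧ ∀ s t, 0 < t → t < T → r (s + t) ≠ r s

/-- The length of the path `r` between the times `s` and `t`. -/
noncomputable def pathLength (r : ℝ → Space) (s t : ℝ) : ℝ :=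
  ∫ τ in s..t, ‖deriv r τ‖

/-- The complete elliptic integral of the second kind, as a function of the modulus. -/
noncomputable def ellipticE (k : ℝ) : ℝ :=
  ∫ φ in (0 : ℝ)..(Real.pi / 2), Real.sqrt (1 - k ^ 2 * Real.sin φ ^ 2)

end Kepler

/-! The relative position solves `r'' = -μ r / ‖r‖³`, for which energy, angular momentum and the
eccentricity vector are conserved. The decisive move is to replace time by the eccentric anomaly
`E`, defined by `E' = √(μ/a) / ‖r‖`. In this phase the motion becomes linear: both `‖r‖ - a` and the
position relative to the centre of the ellipse satisfy `x'' = -x`, so they rotate with `E`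
(`rotation_of_hasDerivAt`).

The scalar oscillator gives a time `s` with `⟪r, v⟫ = 0` and `‖r‖ ≤ a` (`exists_perigee`). The
vector oscillator, started there, gives `r = a (cos E - e) P + a √(1 - e²) sin E Q` with `P`, `Q`
along position and velocity at `s` (`exists_isEllipticMotion`). Here `e = 1 - ‖r s‖ / a`, which is
less than 1 because `r s ≠ 0`; the circular case needs no separate treatment.

All claims follow from this parametrization. Surjectivity of `E` yields the whole ellipse and the
extremal radii, Kepler's equation yields the period, and the substitution of `E` for time turns the
length into an elliptic integral. The vis-viva equation is conservation of energy alone. -/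

namespace Kepler

variable {V : Type*} [NormedAddCommGroup V] [InnerProductSpace ℝ V]

/-- `r`, with velocity `v`, is a collision-free solution of the Kepler problem `r'' = -μ r / ‖r‖³`. -/
structure IsKeplerMotion (μ : ℝ) (r v : ℝ → V) : Prop where
  ne_zero : ∀ t, r t ≠ 0
  hasDerivAt_pos : ∀ t, HasDerivAt r (v t) t
  hasDerivAt_vel : ∀ t, HasDerivAt v (-(μ / ‖r t‖ ^ 3) • r t) t

/-! ### Constancy, rotation in a phase, and vis-viva -/

/-- A function on the line with zero derivative is constant. -/
theorem eq_of_hasDerivAt_zero {W : Type*} [NormedAddCommGroup W] [NormedSpace ℝ W] {f : ℝ → W}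
    (hf : ∀ t, HasDerivAt f 0 t) (s t : ℝ) : f s = f t :=
  is_const_of_deriv_eq_zero (fun x => (hf x).differentiableAt) (fun x => (hf x).deriv) s t

/-- If `y` is the derivative of `x` and `-x` is the derivative of `y` with respect to the
phase `E`, then `(x, y)` rotates with `E`. -/
theorem rotation_of_hasDerivAt {W : Type*} [NormedAddCommGroup W] [NormedSpace ℝ W]
    {x y : ℝ → W} {E g : ℝ → ℝ} {s : ℝ} (hE : ∀ t, HasDerivAt E (g t) t) (hs : E s = 0)
    (hx : ∀ t, HasDerivAt x (g t • y t) t) (hy : ∀ t, HasDerivAt y (-(g t) • x t) t) (t : ℝ) :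
    x t = Real.cos (E t) • x s + Real.sin (E t) • y s ∧
      y t = Real.cos (E t) • y s - Real.sin (E t) • x s := by
  -- Rotating `(x, y)` back through the angle `E` gives two constants; rotating forward again
  -- recovers `x` and `y`.
  have h1 := eq_of_hasDerivAt_zero
    (f := fun t => Real.cos (E t) • x t - Real.sin (E t) • y t) (fun t =>
      (((hE t).cos.smul (hx t)).sub ((hE t).sin.smul (hy t))).congr_deriv (by module)) t s
  have h2 := eq_of_hasDerivAt_zero
    (f := fun t => Real.sin (E t) • x t + Real.cos (E t) • y t) (fun t =>
      (((hE t).sin.smul (hx t)).add ((hE t).cos.smul (hy t))).congr_deriv (by module)) t s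
  simp only [hs, Real.cos_zero, Real.sin_zero, one_smul, zero_smul, sub_zero, zero_add] at h1 h2
  have h3 := Real.cos_sq_add_sin_sq (E t)
  rw [← h1, ← h2]
  constructor
  · linear_combination (norm := module) (-h3) • x t
  · linear_combination (norm := module) (-h3) • y t

/-- The specific energy in an arbitrary normed space. -/
noncomputable def energy {W : Type*} [NormedAddCommGroup W] (μ : ℝ) (r v : W) : ℝ := (1 / 2) * ‖v‖ ^ 2 - μ / ‖r‖

/-- The vis-viva equation. -/
theorem visViva {W : Type*} [NormedAddCommGroup W] {μ a : ℝ} {r v : W}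
    (ha : energy μ r v = -(μ / (2 * a))) : ‖v‖ ^ 2 = μ * (2 / ‖r‖ - 1 / a) := by
  unfold energy at ha
  have h : μ / (2 * a) = μ * (1 / a) / 2 := by ring
  rw [h] at ha
  linear_combination 2 * ha

/-! ### Conservation laws, the eccentric anomaly and the existence of a perigee -/

namespace IsKeplerMotion

variable {μ : ℝ} {r v : ℝ → V}

theorem norm_pos (H : IsKeplerMotion μ r v) (t : ℝ) : 0 < ‖r t‖ :=
  norm_pos_iff.2 (H.ne_zero t)

theorem hasDerivAt_norm (H : IsKeplerMotion μ r v) (t : ℝ) :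
    HasDerivAt (fun t => ‖r t‖) (inner ℝ (r t) (v t) / ‖r t‖) t := by
  have h0 := H.norm_pos t
  have h := ((H.hasDerivAt_pos t).norm_sq).sqrt (by positivity)
  simp only [Real.sqrt_sq (norm_nonneg _)] at h
  refine HasDerivAt.congr_deriv (h) ?_
  field_simp

theorem hasDerivAt_norm_vel_sq (H : IsKeplerMotion μ r v) (t : ℝ) :
    HasDerivAt (fun t => ‖v t‖ ^ 2) (-(2 * μ / ‖r t‖ ^ 3) * inner ℝ (r t) (v t)) t := by
  refine HasDerivAt.congr_deriv ((H.hasDerivAt_vel t).norm_sq) ?_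
  rw [inner_smul_right, real_inner_comm]
  ring

theorem hasDerivAt_inner (H : IsKeplerMotion μ r v) (t : ℝ) :
    HasDerivAt (fun t => inner ℝ (r t) (v t)) (‖v t‖ ^ 2 - μ / ‖r t‖) t := by
  have h0 := H.norm_pos t
  refine HasDerivAt.congr_deriv ((H.hasDerivAt_pos t).inner ℝ (H.hasDerivAt_vel t)) ?_
  rw [inner_smul_right, real_inner_self_eq_norm_sq, real_inner_self_eq_norm_sq]
  field_simp
  ring

theorem energy_eq (H : IsKeplerMotion μ r v) (s t : ℝ) :
    energy μ (r s) (v s) = energy μ (r t) (v t) := by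
  refine eq_of_hasDerivAt_zero (f := fun t => energy μ (r t) (v t)) (fun t => ?_) s t
  have h0 := H.norm_pos t
  unfold energy
  refine HasDerivAt.congr_deriv (((H.hasDerivAt_norm_vel_sq t).const_mul (1 / 2)).sub
    ((hasDerivAt_const t μ).div (H.hasDerivAt_norm t) h0.ne')) ?_
  field_simp
  ring

/-- Conservation of the square of the angular momentum. -/
theorem gram_eq (H : IsKeplerMotion μ r v) (s t : ℝ) :
    ‖r s‖ ^ 2 * ‖v s‖ ^ 2 - inner ℝ (r s) (v s) ^ 2 =
      ‖r t‖ ^ 2 * ‖v t‖ ^ 2 - inner ℝ (r t) (v t) ^ 2 := by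
  refine eq_of_hasDerivAt_zero
    (f := fun t => ‖r t‖ ^ 2 * ‖v t‖ ^ 2 - inner ℝ (r t) (v t) ^ 2) (fun t => ?_) s t
  have h0 := H.norm_pos t
  refine HasDerivAt.congr_deriv ((((H.hasDerivAt_norm t).pow 2).mul (H.hasDerivAt_norm_vel_sq t)).sub
    ((H.hasDerivAt_inner t).pow 2)) ?_
  dsimp
  field_simp
  ring

/-- Conservation of the eccentricity vector. -/
theorem eccentricityVector_eq (H : IsKeplerMotion μ r v) (s t : ℝ) :
    (‖v s‖ ^ 2 - μ / ‖r s‖) • r s - (inner ℝ (r s) (v s) : ℝ) • v s =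
      (‖v t‖ ^ 2 - μ / ‖r t‖) • r t - (inner ℝ (r t) (v t) : ℝ) • v t := by
  refine eq_of_hasDerivAt_zero
    (f := fun t => (‖v t‖ ^ 2 - μ / ‖r t‖) • r t - (inner ℝ (r t) (v t) : ℝ) • v t)
    (fun t => ?_) s t
  have h0 := H.norm_pos t
  refine HasDerivAt.congr_deriv ((((H.hasDerivAt_norm_vel_sq t).sub
    ((hasDerivAt_const t μ).div (H.hasDerivAt_norm t) h0.ne')).smul (H.hasDerivAt_pos t)).sub
    ((H.hasDerivAt_inner t).smul (H.hasDerivAt_vel t))) ?_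
  dsimp
  match_scalars
  · field_simp
    ring
  · field_simp
    ring

/-- The left side of the vis-viva equation is a square, so `2 / ‖r‖ ≥ 1 / a`: negative energy bounds
the orbit. -/
theorem norm_le_two_mul (hμ : 0 < μ) (H : IsKeplerMotion μ r v) {a t : ℝ} (ha0 : 0 < a)
    (ha : energy μ (r t) (v t) = -(μ / (2 * a))) : ‖r t‖ ≤ 2 * a := by
  have h0 := H.norm_pos t
  have h := visViva ha
  have h2 : 0 ≤ μ * (2 / ‖r t‖ - 1 / a) := h ▸ sq_nonneg _
  have h3 := nonneg_of_mul_nonneg_right h2 hμ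
  rw [sub_nonneg, div_le_div_iff₀ ha0 h0] at h3
  linarith

/-- The eccentric anomaly, counted from the time `s`. -/
theorem exists_anomaly (H : IsKeplerMotion μ r v) (k s : ℝ) :
    ∃ E : ℝ → ℝ, E s = 0 ∧ ∀ t, HasDerivAt E (k / ‖r t‖) t := by
  have hc : Continuous fun t => k / ‖r t‖ :=
    continuous_const.div (continuous_iff_continuousAt.2 fun t => (H.hasDerivAt_norm t).continuousAt)
      fun t => (H.norm_pos t).ne'
  exact ⟨fun t => ∫ τ in s..t, k / ‖r τ‖, by simp, fun t => hc.integral_hasStrictDerivAt s t |>.hasDerivAt⟩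

/-- Boundedness of the orbit keeps `E'` above the positive constant `k / c`, so `E` is unbounded in
both directions. -/
theorem anomaly_surjective (H : IsKeplerMotion μ r v) {k c : ℝ} (hk : 0 < k) (hc : 0 < c)
    (hr : ∀ t, ‖r t‖ ≤ c) {E : ℝ → ℝ} (hE : ∀ t, HasDerivAt E (k / ‖r t‖) t) :
    Function.Surjective E := by
  have hd : Differentiable ℝ E := fun t => (hE t).differentiableAt
  have hle : ∀ ⦃x y⦄, x ≤ y → k / c * (y - x) ≤ E y - E x :=
    mul_sub_le_image_sub_of_le_deriv hd fun t => by
      rw [(hE t).deriv]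
      exact div_le_div_of_nonneg_left hk.le (H.norm_pos t) (hr t)
  have hkc : 0 < k / c := by positivity
  refine hd.continuous.surjective ?_ ?_
  · refine Filter.tendsto_atTop_mono' _ ?_ (Filter.tendsto_atTop_add_const_right _ (E 0)
      (Filter.tendsto_id.const_mul_atTop hkc))
    filter_upwards [Filter.eventually_ge_atTop 0] with t ht
    have := hle ht
    simp only [id]
    linarith
  · refine Filter.tendsto_atBot_mono' _ ?_ (Filter.tendsto_atBot_add_const_right _ (E 0)
      (Filter.tendsto_id.const_mul_atBot hkc))
    filter_upwards [Filter.eventually_le_atBot 0] with t ht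
    have := hle ht
    simp only [id]
    linarith

/-- There is a time at which the radius is stationary and does not exceed `a`. -/
theorem exists_perigee (hμ : 0 < μ) (H : IsKeplerMotion μ r v) {a : ℝ} (ha0 : 0 < a)
    (ha : ∀ t, energy μ (r t) (v t) = -(μ / (2 * a))) :
    ∃ s, inner ℝ (r s) (v s) = 0 ∧ ‖r s‖ ≤ a := by
  have hk2 : Real.sqrt (μ / a) ^ 2 = μ / a := Real.sq_sqrt (by positivity)
  have hk : 0 < Real.sqrt (μ / a) := by positivity
  set k := Real.sqrt (μ / a)
  obtain ⟨E, hE0, hE⟩ := H.exists_anomaly k 0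
  have hsurj := H.anomaly_surjective hk (by positivity : 0 < 2 * a)
    (fun t => H.norm_le_two_mul hμ ha0 (ha t)) hE
  -- With respect to `E`, `‖r‖ - a` has derivative `⟪r, v⟫ / k`, whose own derivative is `a - ‖r‖`
  -- by vis-viva and `k² = μ / a`.
  have hrot := rotation_of_hasDerivAt (x := fun t => ‖r t‖ - a)
    (y := fun t => inner ℝ (r t) (v t) / k) hE hE0
    (fun t => by
      have h0 := H.norm_pos t
      refine HasDerivAt.congr_deriv ((H.hasDerivAt_norm t).sub_const a) ?_
      simp only [smul_eq_mul]
      field_simp)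
    (fun t => by
      have h0 := H.norm_pos t
      refine HasDerivAt.congr_deriv ((H.hasDerivAt_inner t).div_const k) ?_
      rw [visViva (ha t), smul_eq_mul]
      field_simp at hk2 ⊢
      linear_combination (‖r t‖ - a) * hk2)
  set α := ‖r 0‖ - a
  set β := inner ℝ (r 0) (v 0) / k
  -- At this phase the initial vector `(α, β)` of length `ρ` has been rotated to `(-ρ, 0)`.
  obtain ⟨s, hs⟩ := hsurj (Complex.arg ⟨-α, -β⟩)
  have hα := Complex.norm_mul_cos_arg ⟨-α, -β⟩
  have hβ := Complex.norm_mul_sin_arg ⟨-α, -β⟩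
  obtain ⟨h1, h2⟩ := hrot s
  rw [hs] at h1 h2
  have hρ := norm_nonneg (⟨-α, -β⟩ : ℂ)
  generalize ‖(⟨-α, -β⟩ : ℂ)‖ = ρ at *
  generalize Complex.arg ⟨-α, -β⟩ = φ at *
  simp only [smul_eq_mul] at hα hβ h1 h2
  have hcs := Real.cos_sq_add_sin_sq φ
  refine ⟨s, ?_, ?_⟩
  · have : inner ℝ (r s) (v s) / k = 0 := by
      rw [h2]
      linear_combination Real.cos φ * hβ - Real.sin φ * hα
    simpa [hk.ne'] using this
  · have : ‖r s‖ - a = -ρ := by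
      rw [h1]
      linear_combination Real.cos φ * hα + Real.sin φ * hβ - ρ * hcs
    linarith

end IsKeplerMotion
end Kepler

/-! ### Explicit parametrization of the orbit by the eccentric anomaly -/

namespace Kepler

/-- The motion `r` is given by the eccentric anomaly `E`, which vanishes at the time `s`, on an
ellipse with semi-major axis `a`, eccentricity `e` and axes spanned by `P` and `Q`. -/
structure IsEllipticMotion {V : Type*} [NormedAddCommGroup V] [InnerProductSpace ℝ V]
    (μ a e s : ℝ) (P Q : V) (E : ℝ → ℝ) (r : ℝ → V) : Prop where
  mu_pos : 0 < μ
  semiaxis_pos : 0 < a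
  ecc_nonneg : 0 ≤ e
  ecc_lt_one : e < 1
  norm_left : ‖P‖ = 1
  norm_right : ‖Q‖ = 1
  inner_eq_zero : inner ℝ P Q = 0
  anomaly_zero : E s = 0
  hasDerivAt_anomaly : ∀ t, HasDerivAt E (Real.sqrt (μ / a) / ‖r t‖) t
  anomaly_surjective : Function.Surjective E
  pos_eq : ∀ t, r t = (a * (Real.cos (E t) - e)) • P +
    (a * Real.sqrt (1 - e ^ 2) * Real.sin (E t)) • Q

section

variable {V : Type*} [NormedAddCommGroup V] [InnerProductSpace ℝ V]

/-- A motion of negative energy is elliptic; its anomaly can be counted from any perigee. -/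
theorem IsKeplerMotion.exists_isEllipticMotion {μ : ℝ} {r v : ℝ → V} (hμ : 0 < μ)
    (H : IsKeplerMotion μ r v) {a s : ℝ} (ha0 : 0 < a)
    (ha : ∀ t, energy μ (r t) (v t) = -(μ / (2 * a))) (hs : inner ℝ (r s) (v s) = 0)
    (hsa : ‖r s‖ ≤ a) :
    ∃ (P Q : V) (E : ℝ → ℝ), IsEllipticMotion μ a (1 - ‖r s‖ / a) s P Q E r := by
  have hk2 : Real.sqrt (μ / a) ^ 2 = μ / a := Real.sq_sqrt (by positivity)
  have hk : 0 < Real.sqrt (μ / a) := by positivity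
  obtain ⟨E, hE0, hE⟩ := H.exists_anomaly (Real.sqrt (μ / a)) s
  have hsurj := H.anomaly_surjective hk (by positivity : 0 < 2 * a)
    (fun t => H.norm_le_two_mul hμ ha0 (ha t)) hE
  set k := Real.sqrt (μ / a)
  have hrs := H.norm_pos s
  have hvs := visViva (ha s)
  have hv : 0 < ‖v s‖ := by
    have h1 : 1 / a ≤ 1 / ‖r s‖ := one_div_le_one_div_of_le hrs hsa
    have h2 : 0 < 1 / a := by positivity
    have h3 : 2 / ‖r s‖ = 2 * (1 / ‖r s‖) := by ring
    have h4 : 0 < ‖v s‖ ^ 2 := by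
      rw [hvs]
      exact mul_pos hμ (by linarith)
    exact (norm_nonneg _).lt_of_ne fun h => by simp [← h] at h4
  -- The amplitude of the velocity oscillator at `s` is the semi-minor axis.
  have hb : ‖r s‖ * ‖v s‖ / k = a * Real.sqrt (1 - (1 - ‖r s‖ / a) ^ 2) := by
    rw [← sq_eq_sq₀ (by positivity) (by positivity), mul_pow, Real.sq_sqrt, div_pow, mul_pow, hvs,
      hk2]
    · field_simp
      ring
    · have h1 : ‖r s‖ / a ≤ 1 := (div_le_one ha0).2 hsa
      have h2 : 0 < ‖r s‖ / a := by positivity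
      nlinarith
  -- The eccentricity vector times `-a / μ` is the centre of the ellipse, so `q` is the position
  -- relative to the centre. Differentiating `q` uses that the added term is constant (`hqs`);
  -- recognizing `-q` in the derivative of `(‖r‖ / k) • v` uses its expression at the current time.
  set q : ℝ → V := fun t => r t + (a / μ) •
    ((‖v t‖ ^ 2 - μ / ‖r t‖) • r t - (inner ℝ (r t) (v t) : ℝ) • v t) with hq
  have hqs : ∀ t, q t = r t + (a - ‖r s‖) • (1 / ‖r s‖) • r s := fun t => by
    simp only [hq]
    rw [H.eccentricityVector_eq t s, hs, hvs]
    match_scalars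
    · simp
    · field_simp
      ring
    · simp
  have hrot := rotation_of_hasDerivAt (x := q) (y := fun t => (‖r t‖ / k) • v t) hE hE0
    (fun t => by
      have h0 := H.norm_pos t
      have h1 : q = fun t => r t + (a - ‖r s‖) • (1 / ‖r s‖) • r s := funext hqs
      rw [h1]
      refine HasDerivAt.congr_deriv ((H.hasDerivAt_pos t).add_const _) ?_
      match_scalars
      field_simp)
    (fun t => by
      have h0 := H.norm_pos t
      refine HasDerivAt.congr_deriv
        (((H.hasDerivAt_norm t).div_const k).smul (H.hasDerivAt_vel t)) ?_
      simp only [hq]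
      rw [visViva (ha t)]
      match_scalars
      · field_simp at hk2 ⊢
        linear_combination hk2
      · field_simp at hk2 ⊢
        linear_combination (-inner ℝ (r t) (v t)) * hk2)
  refine ⟨(1 / ‖r s‖) • r s, (1 / ‖v s‖) • v s, E, hμ, ha0, ?_, ?_, ?_, ?_, ?_, hE0, hE, hsurj,
    fun t => ?_⟩
  · rw [sub_nonneg]
    exact (div_le_one ha0).2 hsa
  · have : 0 < ‖r s‖ / a := by positivity
    linarith
  · rw [norm_smul, Real.norm_of_nonneg (by positivity)]
    field_simp
  · rw [norm_smul, Real.norm_of_nonneg (by positivity)]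
    field_simp
  · rw [inner_smul_left, inner_smul_right, hs]
    simp
  · have h := (hrot t).1
    rw [hqs, hqs, ← eq_sub_iff_add_eq] at h
    rw [h, ← hb]
    match_scalars
    · field_simp
      ring
    · field_simp

/-! ### Radius, orbit equation, Kepler's equation and speed -/

namespace IsEllipticMotion

variable {μ a e s : ℝ} {P Q : V} {E : ℝ → ℝ} {r : ℝ → V}

theorem norm_smul_add_smul_sq (h : IsEllipticMotion μ a e s P Q E r) (x y : ℝ) :
    ‖x • P + y • Q‖ ^ 2 = x ^ 2 + y ^ 2 := by
  rw [norm_add_sq_real, inner_smul_left, inner_smul_right, h.inner_eq_zero, norm_smul, norm_smul,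
    h.norm_left, h.norm_right]
  simp

theorem one_sub_sq_pos (h : IsEllipticMotion μ a e s P Q E r) : 0 < 1 - e ^ 2 := by
  nlinarith [h.ecc_nonneg, h.ecc_lt_one]

theorem one_sub_cos_pos (h : IsEllipticMotion μ a e s P Q E r) (x : ℝ) :
    0 < 1 - e * Real.cos x := by
  nlinarith [h.ecc_nonneg, h.ecc_lt_one, Real.cos_le_one x]

/-- By Pythagoras, since `(cos E - e)² + (1 - e²) sin² E` is the perfect square `(1 - e cos E)²`. -/
theorem norm_eq (h : IsEllipticMotion μ a e s P Q E r) (t : ℝ) :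
    ‖r t‖ = a * (1 - e * Real.cos (E t)) := by
  have h1 := h.one_sub_cos_pos (E t)
  have h2 := h.semiaxis_pos
  rw [← sq_eq_sq₀ (norm_nonneg _) (by positivity), h.pos_eq, h.norm_smul_add_smul_sq, mul_pow,
    mul_pow, mul_pow, Real.sq_sqrt h.one_sub_sq_pos.le, Real.sin_sq]
  ring

theorem isLeast_norm (h : IsEllipticMotion μ a e s P Q E r) :
    IsLeast (range fun t => ‖r t‖) (a * (1 - e)) := by
  refine ⟨⟨s, by simp [h.norm_eq, h.anomaly_zero]⟩, ?_⟩
  rintro _ ⟨t, rfl⟩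
  simp only [h.norm_eq]
  have := mul_le_of_le_one_right h.ecc_nonneg (Real.cos_le_one (E t))
  exact mul_le_mul_of_nonneg_left (by linarith) h.semiaxis_pos.le

theorem isGreatest_norm (h : IsEllipticMotion μ a e s P Q E r) :
    IsGreatest (range fun t => ‖r t‖) (a * (1 + e)) := by
  obtain ⟨t, ht⟩ := h.anomaly_surjective Real.pi
  refine ⟨⟨t, by simp [h.norm_eq, ht]⟩, ?_⟩
  rintro _ ⟨t, rfl⟩
  simp only [h.norm_eq]
  have := mul_le_mul_of_nonneg_left (Real.neg_one_le_cos (E t)) h.ecc_nonneg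
  exact mul_le_mul_of_nonneg_left (by linarith) h.semiaxis_pos.le

/-- The equation of the orbit in polar coordinates. -/
theorem norm_eq_div (h : IsEllipticMotion μ a e s P Q E r) (t : ℝ) :
    ‖r t‖ = a * (1 - e ^ 2) / (1 + e * Real.cos (InnerProductGeometry.angle (r s) (r t))) := by
  have ha := h.semiaxis_pos
  have h1 := h.one_sub_cos_pos (E t)
  have h2 := h.one_sub_sq_pos
  have he : 0 < 1 - e := sub_pos.2 h.ecc_lt_one
  have hrs : r s = (a * (1 - e)) • P := by simp [h.pos_eq s, h.anomaly_zero]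
  have hin : inner ℝ P (r t) = a * (Real.cos (E t) - e) := by
    rw [h.pos_eq t, inner_add_right, inner_smul_right, inner_smul_right, h.inner_eq_zero,
      real_inner_self_eq_norm_sq, h.norm_left]
    ring
  -- The classical relation between true and eccentric anomaly. Only the cosine enters, so the
  -- unsigned angle suffices.
  have hcos : Real.cos (InnerProductGeometry.angle (r s) (r t)) =
      (Real.cos (E t) - e) / (1 - e * Real.cos (E t)) := by
    rw [hrs, InnerProductGeometry.angle_smul_left_of_pos _ _ (by positivity),
      InnerProductGeometry.cos_angle, hin, h.norm_left, h.norm_eq]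
    field_simp
  have h3 : 1 + e * ((Real.cos (E t) - e) / (1 - e * Real.cos (E t))) =
      (1 - e ^ 2) / (1 - e * Real.cos (E t)) := by
    field_simp
    ring
  rw [hcos, h3, h.norm_eq]
  field_simp

theorem sqrt_semiaxis_mul (h : IsEllipticMotion μ a e s P Q E r) :
    Real.sqrt (μ / a) / a * Real.sqrt (a ^ 3 / μ) = 1 := by
  have ha := h.semiaxis_pos
  have hμ := h.mu_pos
  rw [div_mul_eq_mul_div, ← Real.sqrt_mul (by positivity),
    show μ / a * (a ^ 3 / μ) = a ^ 2 by field_simp, Real.sqrt_sq ha.le, div_self ha.ne']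

/-- Kepler's equation. -/
theorem keplerEquation (h : IsEllipticMotion μ a e s P Q E r) (t : ℝ) :
    E t - e * Real.sin (E t) = Real.sqrt (μ / a) / a * (t - s) := by
  have ha := h.semiaxis_pos
  -- `(1 - e cos E) E'` is constant in time because `‖r‖ = a (1 - e cos E)` cancels the denominator
  -- of `E'`.
  have := eq_of_hasDerivAt_zero
    (f := fun t => E t - e * Real.sin (E t) - Real.sqrt (μ / a) / a * (t - s)) (fun t => by
      have h1 := h.one_sub_cos_pos (E t)
      refine HasDerivAt.congr_deriv (((h.hasDerivAt_anomaly t).sub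
        ((h.hasDerivAt_anomaly t).sin.const_mul e)).sub
        (((hasDerivAt_id t).sub_const s).const_mul _)) ?_
      rw [h.norm_eq]
      field_simp
      ring) t s
  simp only [h.anomaly_zero, Real.sin_zero, sub_self, mul_zero] at this
  linarith

/-- Makes Kepler's equation determine `E` from the time; monotonicity and the period of the anomaly
both rest on this. -/
theorem strictMono_kepler (h : IsEllipticMotion μ a e s P Q E r) :
    StrictMono fun x => x - e * Real.sin x := by
  refine strictMono_of_deriv_pos fun x => ?_
  have : HasDerivAt (fun x => x - e * Real.sin x) (1 - e * Real.cos x) x :=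
    (hasDerivAt_id x).sub ((Real.hasDerivAt_sin x).const_mul e)
  rw [this.deriv]
  exact h.one_sub_cos_pos x

theorem strictMono_anomaly (h : IsEllipticMotion μ a e s P Q E r) : StrictMono E := by
  intro t u htu
  have ha := h.semiaxis_pos
  have hμ := h.mu_pos
  rw [← h.strictMono_kepler.lt_iff_lt]
  simp only [h.keplerEquation]
  have : 0 < Real.sqrt (μ / a) / a := by positivity
  gcongr

/-- Both sides give the same value of `x - e sin x`: the mean anomaly grows by `2π` in this time,
and `sin` is unchanged by `2π`. -/
theorem anomaly_add_period (h : IsEllipticMotion μ a e s P Q E r) (t : ℝ) :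
    E (t + 2 * Real.pi * Real.sqrt (a ^ 3 / μ)) = E t + 2 * Real.pi := by
  apply h.strictMono_kepler.injective
  simp only [Real.sin_add_two_pi]
  linear_combination h.keplerEquation (t + 2 * Real.pi * Real.sqrt (a ^ 3 / μ)) -
    h.keplerEquation t + 2 * Real.pi * h.sqrt_semiaxis_mul

theorem periodic (h : IsEllipticMotion μ a e s P Q E r) :
    Function.Periodic r (2 * Real.pi * Real.sqrt (a ^ 3 / μ)) := fun t => by
  rw [h.pos_eq, h.pos_eq, h.anomaly_add_period, Real.cos_add_two_pi, Real.sin_add_two_pi]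

/-- The position determines the eccentric anomaly up to multiples of `2π`. -/
theorem anomaly_eq_of_eq (h : IsEllipticMotion μ a e s P Q E r) {t u : ℝ} (htu : r t = r u) :
    ∃ n : ℤ, E t = E u + n * (2 * Real.pi) := by
  have ha := h.semiaxis_pos
  have h1 : 0 < Real.sqrt (1 - e ^ 2) := Real.sqrt_pos.2 h.one_sub_sq_pos
  have h2 : ‖(a * (Real.cos (E t) - Real.cos (E u))) • P +
      (a * Real.sqrt (1 - e ^ 2) * (Real.sin (E t) - Real.sin (E u))) • Q‖ ^ 2 = 0 := by
    rw [h.pos_eq t, h.pos_eq u, ← sub_eq_zero] at htu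
    rw [sq_eq_zero_iff, norm_eq_zero, ← htu]
    module
  rw [h.norm_smul_add_smul_sq, add_eq_zero_iff_of_nonneg (sq_nonneg _) (sq_nonneg _)] at h2
  have hc : Real.cos (E t) = Real.cos (E u) := by
    have := h2.1
    simp only [sq_eq_zero_iff, mul_eq_zero, ha.ne', false_or] at this
    linarith
  have hs : Real.sin (E t) = Real.sin (E u) := by
    have := h2.2
    simp only [sq_eq_zero_iff, mul_eq_zero, ha.ne', h1.ne', false_or] at this
    linarith
  have h3 : (E t : Real.Angle) = E u := Real.Angle.cos_sin_inj hc hs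
  obtain ⟨n, hn⟩ := Real.Angle.angle_eq_iff_two_pi_dvd_sub.1 h3
  exact ⟨n, by linarith⟩

theorem hasDerivAt_pos (h : IsEllipticMotion μ a e s P Q E r) (t : ℝ) :
    HasDerivAt r ((Real.sqrt (μ / a) / ‖r t‖) • ((-a * Real.sin (E t)) • P +
      (a * Real.sqrt (1 - e ^ 2) * Real.cos (E t)) • Q)) t := by
  have hE := h.hasDerivAt_anomaly t
  have h1 := (((hE.cos.sub_const e).const_mul a).smul_const P).add
    ((hE.sin.const_mul (a * Real.sqrt (1 - e ^ 2))).smul_const Q)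
  refine (h1.congr_of_eventuallyEq (.of_forall h.pos_eq)).congr_deriv ?_
  match_scalars <;> ring

theorem norm_deriv (h : IsEllipticMotion μ a e s P Q E r) (t : ℝ) :
    ‖deriv r t‖ = a * Real.sqrt (1 - e ^ 2 * Real.cos (E t) ^ 2) *
      (Real.sqrt (μ / a) / ‖r t‖) := by
  have ha := h.semiaxis_pos
  rw [(h.hasDerivAt_pos t).deriv, norm_smul, Real.norm_of_nonneg (by positivity), mul_comm]
  congr 1
  have h0 : 0 ≤ 1 - e ^ 2 * Real.cos (E t) ^ 2 := by
    nlinarith [h.one_sub_sq_pos, Real.cos_sq_le_one (E t), sq_nonneg e]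
  rw [← sq_eq_sq₀ (norm_nonneg _) (by positivity), h.norm_smul_add_smul_sq, mul_pow, mul_pow,
    mul_pow, mul_pow, Real.sq_sqrt h.one_sub_sq_pos.le, Real.sq_sqrt h0, Real.sin_sq]
  ring

end IsEllipticMotion

end

/-! ### Perimeter, orbital period and the orbit as a set -/

/-- The perimeter of an ellipse in terms of the complete elliptic integral. -/
theorem integral_sqrt_one_sub_cos_sq (k x : ℝ) :
    ∫ φ in x..x + 2 * Real.pi, Real.sqrt (1 - k ^ 2 * Real.cos φ ^ 2) = 4 * ellipticE k := by
  set f : ℝ → ℝ := fun φ => Real.sqrt (1 - k ^ 2 * Real.cos φ ^ 2) with hf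
  have hfc : Continuous f := by fun_prop
  have hp : Function.Periodic f Real.pi := fun φ => by simp [hf, Real.cos_add_pi]
  have hint : ∀ a b, IntervalIntegrable f MeasureTheory.volume a b := fun a b =>
    hfc.intervalIntegrable a b
  -- `cos²` has period `π`, so any interval of length `2π` counts as two copies of `[-π/2, π/2]`; on
  -- each half of that, a shift or reflection by `π/2` turns `cos` into `sin`.
  have h1 : ∫ φ in x..x + 2 * Real.pi, f φ = 2 * ∫ φ in (-(Real.pi / 2))..Real.pi / 2, f φ := by
    rw [← intervalIntegral.integral_add_adjacent_intervals (hint x (x + Real.pi)) (hint _ _),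
      show x + 2 * Real.pi = x + Real.pi + Real.pi by ring,
      hp.intervalIntegral_add_eq x (-(Real.pi / 2)),
      hp.intervalIntegral_add_eq (x + Real.pi) (-(Real.pi / 2)),
      show -(Real.pi / 2) + Real.pi = Real.pi / 2 by ring]
    ring
  have h2 : ∫ φ in (-(Real.pi / 2))..0, f φ = ellipticE k := by
    unfold ellipticE
    have := intervalIntegral.integral_comp_sub_right (a := 0) (b := Real.pi / 2) f (Real.pi / 2)
    rw [zero_sub, sub_self] at this
    rw [← this]
    simp [hf, Real.cos_sub_pi_div_two]
  have h3 : ∫ φ in 0..Real.pi / 2, f φ = ellipticE k := by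
    unfold ellipticE
    have := intervalIntegral.integral_comp_sub_left (a := 0) (b := Real.pi / 2) f (Real.pi / 2)
    rw [sub_zero, sub_self] at this
    rw [← this]
    simp [hf, Real.cos_pi_div_two_sub]
  rw [h1, ← intervalIntegral.integral_add_adjacent_intervals (hint _ 0) (hint _ _), h2, h3]
  ring

namespace IsEllipticMotion

variable {μ a e s : ℝ} {P Q : Space} {E : ℝ → ℝ} {r : ℝ → Space}

/-- In a time shorter than the period `E` gains strictly between `0` and `2π`, whereas a return to
the same position needs a multiple of `2π`. -/
theorem isOrbitalPeriod (h : IsEllipticMotion μ a e s P Q E r) :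
    IsOrbitalPeriod r (2 * Real.pi * Real.sqrt (a ^ 3 / μ)) := by
  have ha := h.semiaxis_pos
  have hμ := h.mu_pos
  refine ⟨by positivity, h.periodic, fun u t ht htT heq => ?_⟩
  obtain ⟨n, hn⟩ := h.anomaly_eq_of_eq heq
  have h1 : E u < E (u + t) := h.strictMono_anomaly (by linarith)
  have h2 : E (u + t) < E u + 2 * Real.pi := by
    rw [← h.anomaly_add_period]
    exact h.strictMono_anomaly (by linarith)
  have hn0 : 0 < n := by
    by_contra! hle
    have : (n : ℝ) ≤ 0 := by exact_mod_cast hle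
    nlinarith [Real.pi_pos]
  have hn1 : n < 1 := by
    by_contra! hle
    have : (1 : ℝ) ≤ n := by exact_mod_cast hle
    nlinarith [Real.pi_pos]
  omega

theorem isKeplerianEllipse (h : IsEllipticMotion μ a e s P Q E r) :
    IsKeplerianEllipse (range r) a (a * Real.sqrt (1 - e ^ 2)) e := by
  have ha := h.semiaxis_pos
  have he := h.one_sub_sq_pos
  have hq : 0 < Real.sqrt (1 - e ^ 2) := Real.sqrt_pos.2 he
  have hq2 : Real.sqrt (1 - e ^ 2) ^ 2 = 1 - e ^ 2 := Real.sq_sqrt he.le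
  refine ⟨by positivity, ?_, ?_, (-(a * e)) • P, P, Q, h.norm_left, h.norm_right,
    h.inner_eq_zero, ?_, ?_⟩
  · exact mul_le_of_le_one_right ha.le (Real.sqrt_le_one.2 (by nlinarith))
  · rw [mul_pow, hq2, mul_div_cancel_left₀ _ (by positivity), sub_sub_cancel,
      Real.sqrt_sq h.ecc_nonneg]
  · rw [mul_pow, hq2, show a ^ 2 - a ^ 2 * (1 - e ^ 2) = (a * e) ^ 2 by ring,
      Real.sqrt_sq (mul_nonneg ha.le h.ecc_nonneg)]
    module
  · ext z
    constructor
    · rintro ⟨t, rfl⟩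
      refine ⟨a * Real.cos (E t), a * Real.sqrt (1 - e ^ 2) * Real.sin (E t), ?_, ?_⟩
      · field_simp
        rw [Real.cos_sq_add_sin_sq]
      · rw [h.pos_eq]
        module
    · rintro ⟨x, y, hxy, rfl⟩
      -- Scaling the axes to unit length puts the point on the unit circle; its argument is a value
      -- of `E`.
      set ζ : ℂ := ⟨x / a, y / (a * Real.sqrt (1 - e ^ 2))⟩ with hζ
      have hn : ‖ζ‖ = 1 := by
        rw [← sq_eq_sq₀ (norm_nonneg _) zero_le_one, one_pow, ← hxy, Complex.sq_norm,
          Complex.normSq_mk]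
        ring
      have hc := Complex.norm_mul_cos_arg ζ
      have hs := Complex.norm_mul_sin_arg ζ
      obtain ⟨t, ht⟩ := h.anomaly_surjective (Complex.arg ζ)
      rw [hn, one_mul, ← ht] at hc hs
      refine ⟨t, ?_⟩
      rw [h.pos_eq, hc, hs]
      simp only [hζ]
      match_scalars <;> field_simp
      ring

/-- The speed is `E'` times a function of `E`, so the integral becomes one over an `E`-interval of
length `2π`, wherever it starts. -/
theorem pathLength_eq (h : IsEllipticMotion μ a e s P Q E r) (t : ℝ) :
    pathLength r t (t + 2 * Real.pi * Real.sqrt (a ^ 3 / μ)) = 4 * a * ellipticE e := by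
  have hEc : Continuous E := continuous_iff_continuousAt.2 fun t =>
    (h.hasDerivAt_anomaly t).continuousAt
  have hrc : Continuous r := continuous_iff_continuousAt.2 fun t =>
    (h.hasDerivAt_pos t).continuousAt
  have hr0 : ∀ t, ‖r t‖ ≠ 0 := fun t => by
    rw [h.norm_eq]
    exact (mul_pos h.semiaxis_pos (h.one_sub_cos_pos _)).ne'
  unfold pathLength
  simp only [h.norm_deriv]
  have := intervalIntegral.integral_comp_mul_deriv (a := t)
    (b := t + 2 * Real.pi * Real.sqrt (a ^ 3 / μ)) (f := E)
    (f' := fun t => Real.sqrt (μ / a) / ‖r t‖)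
    (g := fun φ => a * Real.sqrt (1 - e ^ 2 * Real.cos φ ^ 2))
    (fun t _ => h.hasDerivAt_anomaly t)
    (continuous_const.div hrc.norm hr0).continuousOn (by fun_prop)
  simp only [Function.comp_def] at this
  rw [this, h.anomaly_add_period, intervalIntegral.integral_const_mul,
    integral_sqrt_one_sub_cos_sq]
  ring

end IsEllipticMotion

theorem IsOrbitalPeriod.unique {r : ℝ → Space} {S T : ℝ} (hS : IsOrbitalPeriod r S)
    (hT : IsOrbitalPeriod r T) : S = T := by
  rcases lt_trichotomy S T with h | h | h
  · exact absurd (hS.2.1 0) (hT.2.2 0 S hS.1 h)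
  · exact h
  · exact absurd (hT.2.1 0) (hS.2.2 0 T hT.1 h)

end Kepler

/-! ### From the two-body problem to the main theorem -/

namespace Kepler

/-- The relative position in the two-body problem solves the Kepler problem. -/
theorem IsTwoBodyMotion.isKeplerMotion {G M m : ℝ} (hM : 0 < M) (hm : 0 < m)
    {xE xL : ℝ → Space} (h : IsTwoBodyMotion G M m xE xL) :
    IsKeplerMotion (G * (M + m)) (fun t => xL t - xE t) (deriv fun t => xL t - xE t) := by
  have hd : (deriv fun t => xL t - xE t) = fun t => deriv xL t - deriv xE t :=
    funext fun t => deriv_fun_sub (h.differentiable_L t) (h.differentiable_E t)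
  refine ⟨fun t => sub_ne_zero.2 (h.no_collision t).symm, fun t => ?_, fun t => ?_⟩
  · rw [hd]
    exact (h.differentiable_L t).hasDerivAt.sub (h.differentiable_E t).hasDerivAt
  · rw [hd]
    refine ((h.differentiable_deriv_L t).hasDerivAt.sub
      (h.differentiable_deriv_E t).hasDerivAt).congr_deriv ?_
    have hE : deriv (deriv xE) t = (G * m / ‖xL t - xE t‖ ^ 3) • (xL t - xE t) := by
      refine smul_right_injective _ hM.ne' ?_
      simp only [h.newton_E t, smul_smul]
      congr 1
      ring
    have hL : deriv (deriv xL) t = (G * M / ‖xL t - xE t‖ ^ 3) • (xE t - xL t) := by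
      refine smul_right_injective _ hm.ne' ?_
      simp only [h.newton_L t, smul_smul, norm_sub_rev (xE t)]
      congr 1
      ring
    rw [hE, hL]
    module

/-- Lagrange's identity. -/
theorem norm_cross_sq (u v : Space) :
    ‖cross u v‖ ^ 2 = ‖u‖ ^ 2 * ‖v‖ ^ 2 - inner ℝ u v ^ 2 := by
  simp only [EuclideanSpace.norm_sq_eq, PiLp.inner_apply, Fin.sum_univ_three, cross,
    cross_apply, Real.norm_eq_abs, sq_abs]
  simp
  ring

end Kepler

theorem mainTheorem4
    (G M_E m_LEO : ℝ) (hG : 0 < G) (hM : 0 < M_E) (hm : 0 < m_LEO)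
    (xE xL : ℝ → Kepler.Space) (hmotion : Kepler.IsTwoBodyMotion G M_E m_LEO xE xL)
    (r : ℝ → Kepler.Space) (hr : ∀ t, r t = xL t - xE t)
    (μ : ℝ) (hμ : μ = G * (M_E + m_LEO))
    (t₀ ε h : ℝ)
    (hε : ε = Kepler.specificEnergy μ (r t₀) (deriv r t₀))
    (hh : h = Kepler.specificAngularMomentum (r t₀) (deriv r t₀))
    -- the orbit is elliptical: bound and not contained in a line
    (hε_neg : ε < 0) (hh_pos : 0 < h)
    (a e b p : ℝ)
    (ha : a = -(μ / (2 * ε)))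
    (he : e = Real.sqrt (1 + 2 * ε * h ^ 2 / μ ^ 2))
    (hb : b = a * Real.sqrt (1 - e ^ 2))
    (hp : p = h ^ 2 / μ) :
    -- the energy and the angular momentum are constants of the motion
    (∀ t, Kepler.specificEnergy μ (r t) (deriv r t) = ε) ∧
    (∀ t, Kepler.specificAngularMomentum (r t) (deriv r t) = h) ∧
    -- the orbit is an ellipse with these parameters and a focus at the origin
    0 ≤ 1 + 2 * ε * h ^ 2 / μ ^ 2 ∧ 0 ≤ e ∧ e < 1 ∧
    Kepler.IsKeplerianEllipse (Set.range r) a b e ∧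
    p = a * (1 - e ^ 2) ∧
    -- the orbit equation; the true anomaly is the angle at the focus from a perigee to the position
    (∀ t_p, IsMinOn (fun t => ‖r t‖) Set.univ t_p → ∀ t,
      ‖r t‖ = p / (1 + e * Real.cos (InnerProductGeometry.angle (r t_p) (r t)))) ∧
    -- perigee and apogee radii exist
    IsLeast (Set.range fun t => ‖r t‖) (a * (1 - e)) ∧
    IsGreatest (Set.range fun t => ‖r t‖) (a * (1 + e)) ∧
    -- the parameters in terms of the perigee and apogee altitudes, and perigee and apogee speeds
    (∀ R H_p H_a r_p r_a : ℝ,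
      IsLeast (Set.range fun t => ‖r t‖ - R) H_p →
      IsGreatest (Set.range fun t => ‖r t‖ - R) H_a →
      r_p = R + H_p → r_a = R + H_a →
        r_p = a * (1 - e) ∧ r_a = a * (1 + e) ∧
        a = (r_p + r_a) / 2 ∧
        e = (r_a - r_p) / (r_a + r_p) ∧
        (∀ t, ‖r t‖ = r_p →
          ‖deriv r t‖ ^ 2 = μ * (2 / r_p - 1 / a) ∧
          ‖deriv r t‖ ^ 2 = μ / a * ((1 + e) / (1 - e))) ∧
        (∀ t, ‖r t‖ = r_a →
          ‖deriv r t‖ ^ 2 = μ * (2 / r_a - 1 / a) ∧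
          ‖deriv r t‖ ^ 2 = μ / a * ((1 - e) / (1 + e)))) ∧
    -- Kepler's third law
    (∀ T, Kepler.IsOrbitalPeriod r T ↔ T = 2 * Real.pi * Real.sqrt (a ^ 3 / μ)) ∧
    -- the circumference, i.e. the length of the trajectory over one revolution
    (∀ T, Kepler.IsOrbitalPeriod r T → ∀ s,
      Kepler.pathLength r s (s + T) = 4 * a * Kepler.ellipticE e) ∧
    -- the vis-viva equation
    (∀ t, ‖deriv r t‖ ^ 2 = μ * (2 / ‖r t‖ - 1 / a)) := by
  have hr' : r = fun t => xL t - xE t := funext hr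
  have hμ0 : 0 < μ := hμ ▸ mul_pos hG (add_pos hM hm)
  have H : Kepler.IsKeplerMotion μ r (deriv r) := by
    rw [hr', hμ]
    exact hmotion.isKeplerMotion hM hm
  have ha0 : 0 < a := by
    rw [ha, ← div_neg]
    exact div_pos hμ0 (by linarith)
  have hεa : ε = -(μ / (2 * a)) := by
    rw [ha]
    field_simp
  have hen : ∀ t, Kepler.specificEnergy μ (r t) (deriv r t) = ε := fun t =>
    (H.energy_eq t t₀).trans hε.symm
  have hena : ∀ t, Kepler.energy μ (r t) (deriv r t) = -(μ / (2 * a)) := fun t =>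
    (hen t).trans hεa
  have hh0 : ∀ t, ‖Kepler.cross (r t) (deriv r t)‖ = h := fun t => by
    rw [hh, Kepler.specificAngularMomentum, ← sq_eq_sq₀ (norm_nonneg _) (norm_nonneg _),
      Kepler.norm_cross_sq, Kepler.norm_cross_sq]
    exact H.gram_eq t t₀
  obtain ⟨s, hs, hsa⟩ := H.exists_perigee hμ0 ha0 hena
  have hrs := H.norm_pos s
  -- At `s` position and velocity are orthogonal, so `h² = ‖r‖² ‖v‖²`, and vis-viva makes the
  -- radicand a square.
  have hrad : 1 + 2 * ε * h ^ 2 / μ ^ 2 = (1 - ‖r s‖ / a) ^ 2 := by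
    rw [← hh0 s, Kepler.norm_cross_sq, hs, Kepler.visViva (hena s), hεa]
    field_simp
    ring
  have hes : 1 - ‖r s‖ / a = e := by
    rw [he, hrad, Real.sqrt_sq]
    rw [sub_nonneg]
    exact (div_le_one ha0).2 hsa
  obtain ⟨P, Q, E, hE⟩ := H.exists_isEllipticMotion hμ0 ha0 hena hs hsa
  rw [hes] at hE hrad
  have he0 := hE.ecc_nonneg
  have he1 : 0 < 1 - e := sub_pos.2 hE.ecc_lt_one
  have hpa : p = a * (1 - e ^ 2) := by
    rw [hp, ← hrad, hεa]
    field_simp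
    ring
  have hvv : ∀ t, ‖deriv r t‖ ^ 2 = μ * (2 / ‖r t‖ - 1 / a) := fun t => Kepler.visViva (hena t)
  refine ⟨hen, hh0, hrad ▸ sq_nonneg e, he0, hE.ecc_lt_one, hb ▸ hE.isKeplerianEllipse, hpa, ?_,
    hE.isLeast_norm, hE.isGreatest_norm, ?_, ?_, ?_, hvv⟩
  · intro t_p htp t
    have hmin : ‖r t_p‖ = a * (1 - e) :=
      IsLeast.unique (s := range fun t => ‖r t‖) ⟨⟨t_p, rfl⟩, by
        rintro _ ⟨u, rfl⟩
        exact htp (mem_univ u)⟩ hE.isLeast_norm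
    -- The radius is stationary at its minimum, so the anomaly may be recounted from `t_p` in place
    -- of `s`; the eccentricity stays `e`.
    have hin : inner ℝ (r t_p) (deriv r t_p) = 0 := by
      have := (htp.isLocalMin Filter.univ_mem).hasDerivAt_eq_zero (H.hasDerivAt_norm t_p)
      simpa [(H.norm_pos t_p).ne'] using this
    obtain ⟨P', Q', E', hE'⟩ := H.exists_isEllipticMotion hμ0 ha0 hena hin
      (hmin.trans_le (mul_le_of_le_one_right ha0.le (by linarith)))
    have : 1 - ‖r t_p‖ / a = e := by
      rw [hmin]
      field_simp
      ring
    rw [this] at hE'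
    rw [hpa]
    exact hE'.norm_eq_div t
  · intro R H_p H_a r_p r_a hHp hHa hrp hra
    have hrp' : r_p = a * (1 - e) := by
      refine IsLeast.unique (s := range fun t => ‖r t‖) ⟨?_, ?_⟩ hE.isLeast_norm
      · obtain ⟨t, ht⟩ := hHp.1
        exact ⟨t, by simp only at ht ⊢; linarith⟩
      · rintro _ ⟨t, rfl⟩
        have := hHp.2 ⟨t, rfl⟩
        simp only at this ⊢
        linarith
    have hra' : r_a = a * (1 + e) := by
      refine IsGreatest.unique (s := range fun t => ‖r t‖) ⟨?_, ?_⟩ hE.isGreatest_norm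
      · obtain ⟨t, ht⟩ := hHa.1
        exact ⟨t, by simp only at ht ⊢; linarith⟩
      · rintro _ ⟨t, rfl⟩
        have := hHa.2 ⟨t, rfl⟩
        simp only at this ⊢
        linarith
    refine ⟨hrp', hra', by rw [hrp', hra']; ring, ?_, fun t ht => ?_, fun t ht => ?_⟩
    · rw [hrp', hra', show a * (1 + e) - a * (1 - e) = 2 * a * e by ring,
        show a * (1 + e) + a * (1 - e) = 2 * a by ring, mul_div_cancel_left₀ _ (by positivity)]
    · refine ⟨ht ▸ hvv t, ?_⟩
      rw [hvv, ht, hrp']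
      field_simp
      ring
    · refine ⟨ht ▸ hvv t, ?_⟩
      rw [hvv, ht, hra']
      field_simp
      ring
  · exact fun T => ⟨fun hT => hT.unique hE.isOrbitalPeriod, fun hT => hT ▸ hE.isOrbitalPeriod⟩
  · intro T hT u
    rw [hT.unique hE.isOrbitalPeriod]
    exact hE.pathLength_eq u
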